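/- Let $R$ be a (not necessarily commutative) ring with identity that is an Asano prime ring, i.e. a prime (left and right) Goldie ring in which every nonzero two-sided ideal $I$ is invertible: in the classical quotient ring $Q$ of $R$ there is an $R$-$R$-subbimodule $J$ with $IJ=JI=R$. Let $\{X_i\}_{i\in I}$ be the set of all maximal (two-sided) ideals of $R$, let $M$ be a unital right $R$-module, and let $Y\subseteq M$ be a generating set of $M$. For an ideal $X$ of $R$ put $C(X)=\sum_{k\ge 1}\{m\in M\mid mX^{k}=0\}$, and for $N\subseteq M$ put $\underline{r}_R(N)=\{r\in R\mid nr=0\text{ for all }n\in N\}$. If $\underline{r}_R(yR)\neq 0$ for every $y\in Y$, then $M$ is the internal direct sum $M=\bigoplus_{i\in I}C(X_i)$. -/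

import Mathlib

open scoped RightActions Pointwise

namespace Asano

/-! Right `R`-modules are modules over `Rᵐᵒᵖ`; `m <• r` is the action of `r : R` on the right.
An ideal of `R` is a (left) `Ideal R` that is two-sided; products and powers are those of `Ideal R`.
-/

section Annihilators

universe u v

variable (R : Type u) [Ring R] {M : Type v} [AddCommGroup M] [Module Rᵐᵒᵖ M]

/-- The right annihilator `{r ∈ R | n r = 0 for all n ∈ N}` of a subset `N` of a right module,
as a right ideal of `R`. -/
def rightAnnihilator (N : Set M) : Submodule Rᵐᵒᵖ R where
  carrier := {r | ∀ n ∈ N, n <• r = 0}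
  zero_mem' := fun n _ => by simp
  add_mem' := fun {a b} ha hb n hn => by
    rw [MulOpposite.op_add, add_smul, ha n hn, hb n hn, add_zero]
  smul_mem' := fun c r hr n hn => by
    have h : MulOpposite.op (c • r) = c * MulOpposite.op r := rfl
    rw [h, mul_smul, hr n hn, smul_zero]

variable {R} (M)

/-- The left annihilator `{m ∈ M | m x = 0 for all x ∈ X}` of an ideal `X` in a right module `M`,
as a submodule of `M`. -/
def leftAnnihilator (X : Ideal R) : Submodule Rᵐᵒᵖ M where
  carrier := {m | ∀ x ∈ X, m <• x = 0}
  zero_mem' := fun x _ => smul_zero _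
  add_mem' := fun {a b} ha hb x hx => by rw [smul_add, ha x hx, hb x hx, add_zero]
  smul_mem' := fun c m hm x hx => by
    have h := hm (c.unop * x) (X.mul_mem_left _ hx)
    rwa [MulOpposite.op_mul, MulOpposite.op_unop, mul_smul] at h

/-- The component of `X` in `M`: the sum over all `k ≥ 1` of the left annihilators of `X ^ k`. -/
def component (X : Ideal R) : Submodule Rᵐᵒᵖ M :=
  ⨆ (k : ℕ) (_ : 1 ≤ k), leftAnnihilator M (X ^ k)

end Annihilators

section Rings

universe u

variable (R : Type u) [Ring R]

/-- A prime ring: `R ≠ 0`, and `a R b = 0` implies `a = 0` or `b = 0`. -/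
def IsPrimeRing : Prop :=
  Nontrivial R ∧ ∀ a b : R, (∀ r : R, a * r * b = 0) → a = 0 ∨ b = 0

/-- A right Goldie ring: there is no infinite direct sum of nonzero right ideals inside `R`
(finite right uniform dimension), and right annihilators of subsets of `R` satisfy the ascending
chain condition. -/
def IsRightGoldie : Prop :=
  (¬ ∃ A : ℕ → Submodule Rᵐᵒᵖ R, (∀ n, A n ≠ ⊥) ∧ iSupIndep A) ∧
    WellFoundedGT {A : Submodule Rᵐᵒᵖ R // ∃ S : Set R, A = rightAnnihilator R S}

/-- A Goldie ring: right Goldie and left Goldie. -/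
def IsGoldie : Prop :=
  IsRightGoldie R ∧ IsRightGoldie Rᵐᵒᵖ

variable {R} {Q : Type u} [Ring Q]

/-- `i : R → Q` exhibits `Q` as the (two-sided) classical quotient ring of `R`: `i` is injective,
regular elements of `R` become units of `Q`, and every element of `Q` is a right fraction `a s⁻¹`
and a left fraction `t⁻¹ b`, with `s`, `t` regular. -/
structure IsQuotientRing (i : R →+* Q) : Prop where
  injective : Function.Injective i
  isUnit : ∀ s ∈ nonZeroDivisors R, IsUnit (i s)
  right_fraction : ∀ q : Q, ∃ a : R, ∃ s ∈ nonZeroDivisors R, q * i s = i a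
  left_fraction : ∀ q : Q, ∃ b : R, ∃ t ∈ nonZeroDivisors R, i t * q = i b

/-- `I` is invertible in the overring `i : R → Q`: there is an `R`-`R`-sub-bimodule `J` of `Q` with
`I J = J I = R`. The product of two additive subgroups is the additive subgroup generated by the
products of their elements. -/
def IsInvertibleIn (i : R →+* Q) (I : Ideal R) : Prop :=
  ∃ J : AddSubgroup Q,
    (∀ (r : R), ∀ q ∈ J, i r * q ∈ J ∧ q * i r ∈ J) ∧
    I.toAddSubgroup.map i.toAddMonoidHom * J = i.range.toAddSubgroup ∧
    J * I.toAddSubgroup.map i.toAddMonoidHom = i.range.toAddSubgroup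

variable (R)

/-- An Asano prime ring (Asano order): a prime Goldie ring in which every nonzero (two-sided) ideal
is invertible, in the quotient ring of `R`. -/
def IsAsanoPrimeRing : Prop :=
  IsPrimeRing R ∧ IsGoldie R ∧
    ∃ (Q : Type u) (_ : Ring Q) (i : R →+* Q), IsQuotientRing i ∧
      ∀ I : Ideal R, I.IsTwoSided → I ≠ ⊥ → IsInvertibleIn i I

variable {R}

/-- `X` is a maximal ideal of `R` in the two-sided sense: a proper two-sided ideal such that every
strictly larger two-sided ideal is `R`. -/
def IsMaximalTwoSided (X : Ideal R) : Prop :=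
  X.IsTwoSided ∧ X ≠ ⊤ ∧ ∀ J : Ideal R, J.IsTwoSided → X < J → J = ⊤

end Rings

end Asano

/-!
A dual basis of an invertible ideal `I`, that is, an expression `1 = ∑ qₖ xₖ` with `xₖ ∈ I` and
`qₖ ∈ I⁻¹`, shows that `I` is finitely generated and that every two-sided ideal inside `I` is of
the form `C I`. Hence two-sided ideals satisfy the ascending chain condition and, for `X` maximal,
every nonzero one is `B Xᵏ` with `B ⊈ X`. As `B` and `Xᵏ` are comaximal and `Xᵏ` is invertible,
`B Xᵏ = B ∩ Xᵏ`, so an element killed by this ideal is a sum of one killed by `B` and one killed by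
`Xᵏ`; by Noetherian induction it lies in the sum of the components. The sum is direct because
comaximal ideals have no common nonzero torsion.
-/

namespace Asano

universe u v

section TwoSidedIdeals

variable {R : Type u} [Ring R]

theorem isTwoSided_iSup {ι : Sort*} (I : ι → Ideal R) [∀ k, (I k).IsTwoSided] :
    (⨆ k, I k).IsTwoSided :=
  ⟨fun b ha => Submodule.iSup_induction I (motive := fun a => a * b ∈ ⨆ k, I k) ha
    (fun k _ hx => Submodule.mem_iSup_of_mem k ((I k).mul_mem_right b hx))
    (by rw [zero_mul]; exact zero_mem _)
    (fun x y hx hy => by rw [add_mul]; exact add_mem hx hy)⟩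

theorem isTwoSided_sup (I J : Ideal R) [I.IsTwoSided] [J.IsTwoSided] : (I ⊔ J).IsTwoSided := by
  rw [sup_eq_iSup]
  have (b : Bool) : (bif b then I else J).IsTwoSided := by cases b <;> assumption
  exact isTwoSided_iSup _

theorem wellFoundedGT_isTwoSided_of_fg (hfg : ∀ I : Ideal R, I.IsTwoSided → I.FG) :
    WellFoundedGT {I : Ideal R // I.IsTwoSided} := by
  rw [wellFoundedGT_iff_monotone_chain_condition]
  intro f
  have hf : Monotone fun n => (f n).1 := fun _ _ h => f.monotone h
  have (n : ℕ) : (f n).1.IsTwoSided := (f n).2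
  have hcompact := (Submodule.fg_iff_compact _).1 (hfg _ (isTwoSided_iSup fun n => (f n).1))
  obtain ⟨_, ⟨n, rfl⟩, hn⟩ := hcompact (Set.range fun n => (f n).1) _ (Set.range_nonempty _)
    hf.directed_le.directedOn_range isLUB_iSup le_rfl
  exact ⟨n, fun m hnm => Subtype.ext ((hf hnm).antisymm ((le_iSup (fun m => (f m).1) m).trans hn))⟩

namespace IsMaximalTwoSided

theorem sup_eq_top_of_not_le {X B : Ideal R} (hX : IsMaximalTwoSided X) [B.IsTwoSided]
    (hB : ¬B ≤ X) : X ⊔ B = ⊤ := by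
  have := hX.1
  exact hX.2.2 _ (isTwoSided_sup X B) (left_lt_sup.2 hB)

theorem sup_eq_top_of_ne {X Y : Ideal R} (hX : IsMaximalTwoSided X) (hY : IsMaximalTwoSided Y)
    (hXY : X ≠ Y) : X ⊔ Y = ⊤ := by
  have := hY.1
  exact hX.sup_eq_top_of_not_le fun hYX => hX.2.1 (hY.2.2 X hX.1 (hYX.lt_of_ne hXY.symm))

end IsMaximalTwoSided

theorem exists_isMaximalTwoSided_ge (A : Ideal R) [hA : A.IsTwoSided] (hA_top : A ≠ ⊤) :
    ∃ X, IsMaximalTwoSided X ∧ A ≤ X := by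
  have chain_bound : ∀ c ⊆ {I : Ideal R | I.IsTwoSided ∧ I ≠ ⊤}, IsChain (· ≤ ·) c → ∀ I ∈ c,
      ∃ U ∈ {I : Ideal R | I.IsTwoSided ∧ I ≠ ⊤}, ∀ J ∈ c, J ≤ U := by
    intro c hc hchain I hI
    have (J : c) : J.1.IsTwoSided := (hc J.2).1
    refine ⟨sSup c, ⟨sSup_eq_iSup' c ▸ isTwoSided_iSup _, fun htop => ?_⟩, fun _ => le_sSup⟩
    obtain ⟨J, hJ, hJ_one⟩ := (Submodule.mem_sSup_of_directed ⟨I, hI⟩ hchain.directedOn).1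
      ((Ideal.eq_top_iff_one _).1 htop)
    exact (hc hJ).2 ((Ideal.eq_top_iff_one J).2 hJ_one)
  obtain ⟨X, hAX, hX⟩ := zorn_le_nonempty₀ _ chain_bound A ⟨hA, hA_top⟩
  refine ⟨X, ⟨hX.prop.1, hX.prop.2, fun J hJ hXJ => ?_⟩, hAX⟩
  by_contra hJ_top
  exact hX.not_prop_of_gt hXJ ⟨hJ, hJ_top⟩

end TwoSidedIdeals

section DualBases

theorem exists_eq_sum_of_mem_mul {Q : Type u} [Ring Q] {A B : AddSubgroup Q} {z : Q}
    (hz : z ∈ A * B) :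
    ∃ (ι : Type) (_ : Fintype ι) (a : ι → A) (b : ι → B), z = ∑ k, (a k : Q) * b k := by
  refine AddSubmonoid.mul_induction_on hz (fun a ha b hb => ?_) ?_
  · exact ⟨Unit, inferInstance, fun _ => ⟨a, ha⟩, fun _ => ⟨b, hb⟩, by simp⟩
  · rintro _ _ ⟨ι, _, a, b, rfl⟩ ⟨κ, _, c, d, rfl⟩
    exact ⟨ι ⊕ κ, inferInstance, Sum.elim a c, Sum.elim b d, by simp⟩

variable {R Q : Type u} [Ring R] [Ring Q] {i : R →+* Q} {I : Ideal R}

/-- The families `x` in `I` and `q` in the inverse of `I` form a dual basis of `I`, that is,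
`∑ qₖ xₖ = 1`. That `qₖ` lies in the inverse of `I` is recorded as `qₖ I ⊆ R` and `I qₖ ⊆ R`. -/
structure IsDualBasis {ι : Type*} [Fintype ι] (i : R →+* Q) (I : Ideal R) (q : ι → Q)
    (x : ι → R) : Prop where
  mem : ∀ k, x k ∈ I
  left_mul_mem : ∀ k, ∀ y ∈ I, q k * i y ∈ i.range
  right_mul_mem : ∀ k, ∀ y ∈ I, i y * q k ∈ i.range
  sum_eq_one : ∑ k, q k * i (x k) = 1

theorem IsInvertibleIn.exists_isDualBasis (hI : IsInvertibleIn i I) :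
    ∃ (ι : Type) (_ : Fintype ι) (q : ι → Q) (x : ι → R), IsDualBasis i I q x := by
  obtain ⟨J, -, hIJ, hJI⟩ := hI
  have one_mem : (1 : Q) ∈ J * I.toAddSubgroup.map i.toAddMonoidHom := hJI ▸ one_mem i.range
  obtain ⟨ι, _, q, b, hsum⟩ := exists_eq_sum_of_mem_mul one_mem
  choose x hx hxb using fun k => (b k).2
  refine ⟨ι, inferInstance, fun k => q k, x, hx, fun k y hy => ?_, fun k y hy => ?_, ?_⟩
  · exact hJI.le (AddSubmonoid.mul_mem_mul (q k).2 ⟨y, hy, rfl⟩)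
  · exact hIJ.le (AddSubmonoid.mul_mem_mul ⟨y, hy, rfl⟩ (q k).2)
  · rw [hsum]
    exact Finset.sum_congr rfl fun k _ => congrArg ((q k : Q) * ·) (hxb k)

namespace IsDualBasis

variable {ι : Type*} [Fintype ι] {q : ι → Q} {x : ι → R}

theorem exists_eq_sum_mul (hi : Function.Injective i) (h : IsDualBasis i I q x) {y : R}
    (hy : y ∈ I) : ∃ r : ι → R, (∀ k, i (r k) = i y * q k) ∧ y = ∑ k, r k * x k := by
  choose r hr using fun k => h.right_mul_mem k y hy
  refine ⟨r, hr, hi ?_⟩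
  calc i y = i y * ∑ k, q k * i (x k) := by rw [h.sum_eq_one, mul_one]
    _ = i (∑ k, r k * x k) := by simp only [Finset.mul_sum, map_sum, map_mul, hr, mul_assoc]

theorem exists_eq_mul_of_mem_mul (h : IsDualBasis i I q x) (k : ι) {X : Ideal R} {z : R}
    (hz : z ∈ I * X) : ∃ s ∈ X, i s = q k * i z := by
  induction hz using Submodule.mul_induction_on' with
  | mem_mul_mem y hy w hw =>
    obtain ⟨r, hr⟩ := h.left_mul_mem k y hy
    exact ⟨r * w, X.mul_mem_left r hw, by rw [map_mul, map_mul, hr, mul_assoc]⟩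
  | add y _ z _ hy hz =>
    obtain ⟨s, hs, hsy⟩ := hy
    obtain ⟨t, ht, htz⟩ := hz
    exact ⟨s + t, add_mem hs ht, by rw [map_add, map_add, hsy, htz, mul_add]⟩

end IsDualBasis

end DualBases

section InvertibleIdeals

variable {R Q : Type u} [Ring R] [Ring Q] {i : R →+* Q} {I J : Ideal R}

namespace IsInvertibleIn

theorem fg (hi : Function.Injective i) (hI : IsInvertibleIn i I) : I.FG := by
  obtain ⟨ι, _, q, x, hqx⟩ := hI.exists_isDualBasis
  suffices I = Ideal.span (Set.range x) from
    this ▸ Submodule.fg_span (Set.finite_range x)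
  refine le_antisymm (fun y hy => ?_) (Ideal.span_le.2 (Set.range_subset_iff.2 hqx.mem))
  obtain ⟨r, -, rfl⟩ := hqx.exists_eq_sum_mul hi hy
  exact sum_mem fun k _ => Ideal.mul_mem_left _ _ (Ideal.subset_span ⟨k, rfl⟩)

theorem colon_mul_eq (hi : Function.Injective i) (hI : IsInvertibleIn i I) [J.IsTwoSided]
    (hJI : J ≤ I) : J.colon (I : Set R) * I = J := by
  obtain ⟨ι, _, q, x, hqx⟩ := hI.exists_isDualBasis
  refine le_antisymm (Ideal.mul_le.2 fun r hr y hy => Submodule.mem_colon.1 hr y hy) fun y hy => ?_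
  obtain ⟨r, hr, hsum⟩ := hqx.exists_eq_sum_mul hi (hJI hy)
  have hr_colon (k : ι) : r k ∈ J.colon (I : Set R) := by
    refine Submodule.mem_colon.2 fun w hw => ?_
    obtain ⟨s, hs⟩ := hqx.left_mul_mem k w hw
    have : r k * w = y * s := hi (by rw [map_mul, map_mul, hr, hs, mul_assoc])
    rw [smul_eq_mul, this]
    exact J.mul_mem_right s hy
  exact hsum ▸ sum_mem fun k _ => Ideal.mul_mem_mul (hr_colon k) (hqx.mem k)

theorem eq_top_of_le_mul (hi : Function.Injective i) (hI : IsInvertibleIn i I) {X : Ideal R}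
    (hIX : I ≤ I * X) : X = ⊤ := by
  obtain ⟨ι, _, q, x, hqx⟩ := hI.exists_isDualBasis
  choose s hsX hs using fun k => hqx.exists_eq_mul_of_mem_mul k (hIX (hqx.mem k))
  have sum_eq_one : ∑ k, s k = 1 := hi (by simp only [map_sum, hs, hqx.sum_eq_one, map_one])
  exact (Ideal.eq_top_iff_one X).2 (sum_eq_one ▸ sum_mem fun k _ => hsX k)

theorem inf_le_mul_of_sup_eq_top (hi : Function.Injective i) (hI : IsInvertibleIn i I)
    [I.IsTwoSided] [J.IsTwoSided] (hIJ : I ⊔ J = ⊤) : J ⊓ I ≤ J * I := by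
  have : (J ⊓ I).IsTwoSided := ⟨fun b ha => ⟨J.mul_mem_right b ha.1, I.mul_mem_right b ha.2⟩⟩
  set C := (J ⊓ I).colon (I : Set R)
  have hCI : C * I = J ⊓ I := hI.colon_mul_eq hi inf_le_right
  have hCJ : C ≤ J :=
    calc C = C * (I ⊔ J) := by rw [hIJ, Ideal.mul_top]
      _ = C * I ⊔ C * J := Ideal.mul_sup C I J
      _ ≤ J := sup_le (hCI.le.trans inf_le_left) Ideal.mul_le_right
  exact hCI.ge.trans (Ideal.mul_mono_left hCJ)

end IsInvertibleIn

theorem wellFoundedGT_isTwoSided_of_isInvertibleIn (hi : Function.Injective i)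
    (hinv : ∀ I : Ideal R, I.IsTwoSided → I ≠ ⊥ → IsInvertibleIn i I) :
    WellFoundedGT {I : Ideal R // I.IsTwoSided} := by
  refine wellFoundedGT_isTwoSided_of_fg fun I hI => ?_
  obtain rfl | hI_bot := eq_or_ne I ⊥
  · exact Submodule.fg_bot
  · exact (hinv I hI hI_bot).fg hi

theorem exists_eq_mul_pow_of_isMaximalTwoSided (hi : Function.Injective i)
    (hinv : ∀ I : Ideal R, I.IsTwoSided → I ≠ ⊥ → IsInvertibleIn i I) {X : Ideal R}
    (hX : IsMaximalTwoSided X) (A : Ideal R) [hA : A.IsTwoSided] (hA_bot : A ≠ ⊥) :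
    ∃ (k : ℕ) (B : Ideal R), B.IsTwoSided ∧ ¬B ≤ X ∧ A = B * X ^ k := by
  have := hX.1
  have := wellFoundedGT_isTwoSided_of_isInvertibleIn hi hinv
  obtain ⟨⟨B, hB⟩, ⟨k, hAB : A = B * X ^ k⟩, hB_max⟩ := wellFounded_gt.has_min
    {B : {I : Ideal R // I.IsTwoSided} | ∃ k, A = B.1 * X ^ k}
    ⟨⟨A, hA⟩, 0, by rw [Submodule.pow_zero, Ideal.one_eq_top, Ideal.mul_top]⟩
  have hB_bot : B ≠ ⊥ := fun h => hA_bot (by rw [hAB, h, Ideal.bot_mul])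
  refine ⟨k, B, hB, fun hBX => ?_, hAB⟩
  have hX_bot : X ≠ ⊥ := fun h => hB_bot (le_bot_iff.1 (h ▸ hBX))
  set C := B.colon (X : Set R)
  have hCX : C * X = B := (hinv X hX.1 hX_bot).colon_mul_eq hi hBX
  have hBC : B ≠ C := fun h =>
    hX.2.1 ((hinv B hB hB_bot).eq_top_of_le_mul hi (hCX.ge.trans_eq (by rw [← h])))
  have hAC : A = C * X ^ (k + 1) := by
    rw [hAB, ← hCX, Ideal.mul_assoc, Ideal.IsTwoSided.pow_succ]
  exact hB_max ⟨C, inferInstance⟩ ⟨k + 1, hAC⟩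
    (lt_of_le_of_ne Ideal.le_colon (Subtype.coe_ne_coe.1 hBC))

end InvertibleIdeals

section Components

variable {R : Type u} [Ring R] {M : Type v} [AddCommGroup M] [Module Rᵐᵒᵖ M]

theorem leftAnnihilator_anti : Antitone (leftAnnihilator M : Ideal R → Submodule Rᵐᵒᵖ M) :=
  fun _ _ hXY _ hm x hx => hm x (hXY hx)

theorem leftAnnihilator_top : leftAnnihilator M (⊤ : Ideal R) = ⊥ :=
  (Submodule.eq_bot_iff _).2 fun m hm => by simpa using hm 1 Submodule.mem_top

theorem disjoint_leftAnnihilator_of_sup_eq_top {I J : Ideal R} (hIJ : I ⊔ J = ⊤) :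
    Disjoint (leftAnnihilator M I) (leftAnnihilator M J) := by
  rw [Submodule.disjoint_def]
  intro m hmI hmJ
  obtain ⟨x, hx, y, hy, hxy⟩ := Submodule.mem_sup.1 ((Ideal.eq_top_iff_one _).1 hIJ)
  calc m = m <• (x + y) := by rw [hxy, MulOpposite.op_one, one_smul]
    _ = 0 := by rw [MulOpposite.op_add, add_smul, hmI x hx, hmJ y hy, add_zero]

theorem leftAnnihilator_inf_le_sup_of_sup_eq_top {I J : Ideal R} [I.IsTwoSided] [J.IsTwoSided]
    (hIJ : I ⊔ J = ⊤) :
    leftAnnihilator M (I ⊓ J) ≤ leftAnnihilator M I ⊔ leftAnnihilator M J := by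
  intro m hm
  obtain ⟨x, hx, y, hy, hxy⟩ := Submodule.mem_sup.1 ((Ideal.eq_top_iff_one _).1 hIJ)
  have hmy : m <• y ∈ leftAnnihilator M I := fun c hc => by
    rw [smul_smul, ← MulOpposite.op_mul]
    exact hm _ ⟨I.mul_mem_left y hc, J.mul_mem_right c hy⟩
  have hmx : m <• x ∈ leftAnnihilator M J := fun c hc => by
    rw [smul_smul, ← MulOpposite.op_mul]
    exact hm _ ⟨I.mul_mem_right c hx, J.mul_mem_left x hc⟩
  have hm_eq : m = m <• y + m <• x := by
    rw [← add_smul, ← MulOpposite.op_add, add_comm, hxy, MulOpposite.op_one, one_smul]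
  exact hm_eq ▸ Submodule.add_mem_sup hmy hmx

theorem IsInvertibleIn.leftAnnihilator_mul_le_sup_of_sup_eq_top {Q : Type u} [Ring Q] {i : R →+* Q}
    (hi : Function.Injective i) {I J : Ideal R} (hI : IsInvertibleIn i I) [I.IsTwoSided]
    [J.IsTwoSided] (hIJ : I ⊔ J = ⊤) :
    leftAnnihilator M (J * I) ≤ leftAnnihilator M J ⊔ leftAnnihilator M I :=
  (leftAnnihilator_anti (hI.inf_le_mul_of_sup_eq_top hi hIJ)).trans
    (leftAnnihilator_inf_le_sup_of_sup_eq_top (sup_comm J I ▸ hIJ))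

theorem leftAnnihilator_pow_le_component (X : Ideal R) (k : ℕ) :
    leftAnnihilator M (X ^ k) ≤ component M X :=
  (leftAnnihilator_anti (Ideal.pow_le_pow_right k.le_succ)).trans
    (le_iSup₂_of_le (k + 1) k.succ_pos le_rfl)

theorem mem_component_iff {X : Ideal R} {m : M} :
    m ∈ component M X ↔ ∃ k, m ∈ leftAnnihilator M (X ^ k) := by
  have hmono : Monotone fun k => leftAnnihilator M (X ^ k) :=
    fun _ _ h => leftAnnihilator_anti (Ideal.pow_le_pow_right h)
  have hcomponent : component M X = ⨆ k, leftAnnihilator M (X ^ k) :=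
    le_antisymm (iSup₂_le fun k _ => le_iSup (fun k => leftAnnihilator M (X ^ k)) k)
      (iSup_le (leftAnnihilator_pow_le_component X))
  rw [hcomponent, Submodule.mem_iSup_of_directed _ hmono.directed_le]

variable (M) in
/-- The elements of `M` killed by some two-sided ideal comaximal with `X`. This submodule meets the
component of `X` trivially and contains the components of all ideals comaximal with `X`. -/
def comaximalTorsion (X : Ideal R) : Submodule Rᵐᵒᵖ M where
  carrier := {m | ∃ D : Ideal R, D.IsTwoSided ∧ X ⊔ D = ⊤ ∧ m ∈ leftAnnihilator M D}
  zero_mem' := ⟨⊤, inferInstance, sup_top_eq _, zero_mem _⟩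
  add_mem' := by
    rintro a b ⟨D, hD, hXD, ha⟩ ⟨E, hE, hXE, hb⟩
    refine ⟨D * E, inferInstance, ?_, add_mem (leftAnnihilator_anti Ideal.mul_le_left ha)
      (leftAnnihilator_anti Ideal.mul_le_right hb)⟩
    rwa [Ideal.sup_mul_eq_of_coprime_right hXE]
  smul_mem' := fun c _ ⟨D, hD, hXD, hm⟩ => ⟨D, hD, hXD, Submodule.smul_mem _ c hm⟩

theorem disjoint_component_comaximalTorsion (X : Ideal R) :
    Disjoint (component M X) (comaximalTorsion M X) := by
  rw [Submodule.disjoint_def]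
  rintro m hm ⟨D, _, hXD, hmD⟩
  obtain ⟨k, hk⟩ := mem_component_iff.1 hm
  exact Submodule.disjoint_def.1
    (disjoint_leftAnnihilator_of_sup_eq_top (Ideal.pow_sup_eq_top' hXD)) m hk hmD

theorem component_le_comaximalTorsion {X Y : Ideal R} [Y.IsTwoSided] (hXY : X ⊔ Y = ⊤) :
    component M Y ≤ comaximalTorsion M X := by
  intro m hm
  obtain ⟨k, hk⟩ := mem_component_iff.1 hm
  exact ⟨Y ^ k, inferInstance, Ideal.sup_pow_eq_top' hXY, hk⟩

theorem iSupIndep_component_of_pairwise_sup_eq_top {ι : Type*} {X : ι → Ideal R}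
    [∀ a, (X a).IsTwoSided] (hX : Pairwise fun a b => X a ⊔ X b = ⊤) :
    iSupIndep fun a => component M (X a) := fun a =>
  (disjoint_component_comaximalTorsion (X a)).mono_right
    (iSup₂_le fun _ hba => component_le_comaximalTorsion (hX hba.symm))

theorem iSupIndep_component_isMaximalTwoSided :
    iSupIndep fun X : {X : Ideal R // IsMaximalTwoSided X} => component M X.1 := by
  have (X : {X : Ideal R // IsMaximalTwoSided X}) : X.1.IsTwoSided := X.2.1
  exact iSupIndep_component_of_pairwise_sup_eq_top fun X Y hXY =>
    X.2.sup_eq_top_of_ne Y.2 (Subtype.coe_ne_coe.2 hXY)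

theorem leftAnnihilator_le_iSup_component {Q : Type u} [Ring Q] {i : R →+* Q}
    (hi : Function.Injective i)
    (hinv : ∀ I : Ideal R, I.IsTwoSided → I ≠ ⊥ → IsInvertibleIn i I) (A : Ideal R)
    [hA : A.IsTwoSided] (hA_bot : A ≠ ⊥) :
    leftAnnihilator M A ≤ ⨆ X : {X : Ideal R // IsMaximalTwoSided X}, component M X.1 := by
  have := wellFoundedGT_isTwoSided_of_isInvertibleIn hi hinv
  lift A to {I : Ideal R // I.IsTwoSided} using hA
  induction A using WellFoundedGT.induction with | ind A ih => ?_
  obtain hA_top | hA_top := eq_or_ne A.1 ⊤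
  · rw [hA_top, leftAnnihilator_top]
    exact bot_le
  have := A.2
  obtain ⟨X, hX, hAX⟩ := exists_isMaximalTwoSided_ge A.1 hA_top
  have := hX.1
  obtain ⟨k, B, hB, hBX, hAB⟩ := exists_eq_mul_pow_of_isMaximalTwoSided hi hinv hX A.1 hA_bot
  have hB_bot : B ≠ ⊥ := fun h => hBX (h ▸ bot_le)
  have hXk_bot : X ^ k ≠ ⊥ := fun h => hA_bot (by rw [hAB, h, Ideal.mul_bot])
  have hcoprime : X ^ k ⊔ B = ⊤ := Ideal.pow_sup_eq_top (hX.sup_eq_top_of_not_le hBX)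
  have hA_lt : A < ⟨B, hB⟩ :=
    lt_of_le_of_ne (hAB.le.trans Ideal.mul_le_left)
      fun h => hBX ((congrArg Subtype.val h).ge.trans hAX)
  calc leftAnnihilator M A.1
    _ ≤ leftAnnihilator M B ⊔ leftAnnihilator M (X ^ k) :=
      hAB ▸ (hinv _ inferInstance hXk_bot).leftAnnihilator_mul_le_sup_of_sup_eq_top hi hcoprime
    _ ≤ _ := sup_le (ih ⟨B, hB⟩ hA_lt hB_bot) ((leftAnnihilator_pow_le_component X k).trans
      (le_iSup (fun X : {X : Ideal R // IsMaximalTwoSided X} => component M X.1) ⟨X, hX⟩))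

/-- The right annihilator of a submodule, as a two-sided ideal. -/
def annihilatorIdeal (N : Submodule Rᵐᵒᵖ M) : Ideal R where
  toAddSubmonoid := (rightAnnihilator R (N : Set M)).toAddSubmonoid
  smul_mem' := fun s r hr n hn => by
    rw [smul_eq_mul, MulOpposite.op_mul, mul_smul]
    exact hr _ (N.smul_mem _ hn)

theorem isTwoSided_annihilatorIdeal (N : Submodule Rᵐᵒᵖ M) : (annihilatorIdeal N).IsTwoSided :=
  ⟨fun b ha => (rightAnnihilator R (N : Set M)).smul_mem (MulOpposite.op b) ha⟩

theorem annihilatorIdeal_ne_bot {N : Submodule Rᵐᵒᵖ M}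
    (hN : rightAnnihilator R (N : Set M) ≠ ⊥) : annihilatorIdeal N ≠ ⊥ := fun h =>
  hN (SetLike.coe_injective (congrArg (fun I : Ideal R => (I : Set R)) h))

theorem le_leftAnnihilator_annihilatorIdeal (N : Submodule Rᵐᵒᵖ M) :
    N ≤ leftAnnihilator M (annihilatorIdeal N) :=
  fun n hn _ hr => hr n hn

end Components

end Asano

open Classical in
theorem mainTheorem6_general.{u, v} {R Q : Type u} [Ring R] [Ring Q] {i : R →+* Q}
    (hi : Function.Injective i)
    (hinv : ∀ I : Ideal R, I.IsTwoSided → I ≠ ⊥ → Asano.IsInvertibleIn i I)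
    {M : Type v} [AddCommGroup M] [Module Rᵐᵒᵖ M]
    (Y : Set M) (hY : Submodule.span Rᵐᵒᵖ Y = ⊤)
    (hann : ∀ y ∈ Y, Asano.rightAnnihilator R (Submodule.span Rᵐᵒᵖ {y} : Set M) ≠ ⊥) :
    DirectSum.IsInternal
      (fun X : {X : Ideal R // Asano.IsMaximalTwoSided X} => Asano.component M X.1) := by
  refine DirectSum.isInternal_submodule_of_iSupIndep_of_iSup_eq_top
    Asano.iSupIndep_component_isMaximalTwoSided (top_unique ?_)
  rw [← hY, Submodule.span_le]
  intro y hy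
  have := Asano.isTwoSided_annihilatorIdeal (Submodule.span Rᵐᵒᵖ {y})
  exact Asano.leftAnnihilator_le_iSup_component hi hinv _
    (Asano.annihilatorIdeal_ne_bot (hann y hy))
    (Asano.le_leftAnnihilator_annihilatorIdeal _ (Submodule.mem_span_singleton_self y))

open Classical in
theorem mainTheorem6 {R : Type*} [Ring R] (hR : Asano.IsAsanoPrimeRing R)
    {M : Type*} [AddCommGroup M] [Module Rᵐᵒᵖ M]
    (Y : Set M) (hY : Submodule.span Rᵐᵒᵖ Y = ⊤)
    (hann : ∀ y ∈ Y, Asano.rightAnnihilator R (Submodule.span Rᵐᵒᵖ {y} : Set M) ≠ ⊥) :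
    DirectSum.IsInternal
      (fun X : {X : Ideal R // Asano.IsMaximalTwoSided X} => Asano.component M X.1) := by
  obtain ⟨-, -, _, _, _, hQ, hinv⟩ := hR
  exact mainTheorem6_general hQ.injective hinv Y hY hann
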